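/- **Setting and notation.** All random variables live on one probability space. For two non-negative functions, $f\sim g$ means $f=(1+o(1))\,g$ (equivalently $f/g\to1$ where $g$ is eventually positive), and $x\wedge y\to\infty$ means that $\min(x,y)\to\infty$, with $x,y$ otherwise unrestricted. Let $0<\alpha_1,\alpha_2<\infty$. A pair $(X,Y)$ belongs to $\mathcal R^{(2)}_{(-\alpha_1,-\alpha_2)}$ if for all $t,t_1,t_2>0$ $$\lim_{x\to\infty}\frac{P[X>tx]}{P[X>x]}=t^{-\alpha_1},\quad \lim_{y\to\infty}\frac{P[Y>ty]}{P[Y>y]}=t^{-\alpha_2},\quad \lim_{x\wedge y\to\infty}\frac{P[X>t_1x,\,Y>t_2y]}{P[X>x,\,Y>y]}=t_1^{-\alpha_1}t_2^{-\alpha_2}.$$ Real random variables $X_1,\dots,X_n$ and $Y_1,\dots,Y_m$ are * *GQAI* if, for all $i\ne k$ and all $j$, $\dfrac{P[|X_i|>x,\,X_k>x,\,Y_j>y]}{P[X_i>x,\,Y_j>y]+P[X_k>x,\,Y_j>y]}\to0$ as $x\wedge y\to\infty$, and, for all $j\neq k$ and all $i$, $\dfrac{P[|Y_j|>y,\,Y_k>y,\,X_i>x]}{P[X_i>x,\,Y_j>y]+P[X_i>x,\,Y_k>y]}\to0$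 as $x\wedge y\to\infty$; * *GTAI* if $P[|X_i|>x_i\mid X_k>x_k,\,Y_j>y_j]\to0$ as $x_i\wedge x_k\wedge y_j\to\infty$ for all $i\ne k$ and all $j$, and $P[|Y_j|>y_j\mid Y_k>y_k,\,X_i>x_i]\to0$ as $y_j\wedge y_k\wedge x_i\to\infty$ for all $j\ne k$ and all $i$. $X_1,\dots,X_n$ are *TAI* if $P[|X_i|>x_i\mid X_j>x_j]\to0$ as $x_i\wedge x_j\to\infty$ for all $i\neq j$. The upper Matuszewska index of the distribution $F$ of $X$ is $J_F^+=\inf_{v>1}\bigl(-\ln \overline F_*(v)/\ln v\bigr)$, where $\overline F_*(v)=\liminf_{x\to\infty}P[X>vx]/P[X>x]$. Let $n,m\ge1$ and let $X_1,\dots,X_n,Y_1,\dots,Y_m$ be real random variables with $(X_i,Y_j)\in\mathcal R^{(2)}_{(-\alpha_1,-\alpha_2)}$ for all $i,j$. Let $\Theta_1,\dots,\Theta_n,\Delta_1,\dots,\Delta_m$ be a.s. non-negative random variables, none of them a.s. equal to $0$, arbitrarily dependent among themselves, such that the vector of all the $\Theta_i,\Delta_j$ is independent of the vector of all the $X_i,Y_j$.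 Assume that, for all $i,j$: * **(A)** there are functions $b,c:[0,\infty)\to(0,\infty)$ with $b(x)\to\infty$, $b(x)=o(x)$, $c(x)\to\infty$, $c(x)=o(x)$ as $x\to\infty$, such that $$P[\Theta_i>b(x)]=o\bigl(P[\Theta_iX_i>x,\ \Delta_jY_j>y]\bigr)\quad\text{as }x\to\infty,\text{ uniformly in }y\in\mathbb R,$$ $$P[\Delta_j>c(y)]=o\bigl(P[\Theta_iX_i>x,\ \Delta_jY_j>y]\bigr)\quad\text{as }y\to\infty,\text{ uniformly in }x\in\mathbb R;$$ * **(B)** $E[\Theta_i^{\alpha_1+\varepsilon}\Delta_j^{\alpha_2+\varepsilon}]<\infty$ for some $\varepsilon>0$. Put $S_k^\Theta=\sum_{i=1}^k\Theta_iX_i$ and $T_l^\Delta=\sum_{j=1}^l\Delta_jY_j$. **Claim.** 1. If $X_1,\dots,X_n$ and $Y_1,\dots,Y_m$ are GQAI, then all $E[\Theta_i^{\alpha_1}\Delta_j^{\alpha_2}]$ are finite and, as $x\wedge y\to\infty$, $$P[S_n^\Theta>x,\,T_m^\Delta>y]\sim P\Bigl[\max_{1\le k\le n}S_k^\Theta>x,\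 \max_{1\le l\le m}T_l^\Delta>y\Bigr]\sim\sum_{i=1}^n\sum_{j=1}^mE[\Theta_i^{\alpha_1}\Delta_j^{\alpha_2}]\,P[X_i>x,\,Y_j>y].$$ 2. If $n=m$, the two sequences are GTAI, $X_1,\dots,X_n$ are TAI, $Y_1,\dots,Y_n$ are TAI, and for all $i,j$ we have $E[\Theta_i^p]<\infty$ for some $p>\max_kJ_{F_k}^+$ and $E[\Delta_j^q]<\infty$ for some $q>\max_kJ_{G_k}^+$, where $F_k,G_k$ are the distributions of $X_k,Y_k$, then all $E[\Theta_i^{\alpha_1}\Delta_j^{\alpha_2}]$ are finite and, as $x\wedge y\to\infty$, $$P[S_n^\Theta>x,\,T_n^\Delta>y]\sim P\Bigl[\max_{k\le n}S_k^\Theta>x,\ \max_{l\le n}T_l^\Delta>y\Bigr]\sim P\Bigl[\max_{i\le n}\Theta_iX_i>x,\ \max_{j\le n}\Delta_jY_j>y\Bigr]\sim\sum_{i=1}^n\sum_{j=1}^nE[\Theta_i^{\alpha_1}\Delta_j^{\alpha_2}]\,P[X_i>x,\,Y_j>y].$$ -/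

import Mathlib

open MeasureTheory ProbabilityTheory Filter Topology Asymptotics

noncomputable section

namespace WeightedTails

variable {Ω : Type*} [MeasurableSpace Ω]

/-- The tail `P[X > x]`. -/
def tail (μ : Measure Ω) (X : Ω → ℝ) (x : ℝ) : ℝ :=
  μ.real {ω | x < X ω}

/-- The joint tail (joint excess) `P[X > x, Y > y]`. -/
def jointTail (μ : Measure Ω) (X Y : Ω → ℝ) (x y : ℝ) : ℝ :=
  μ.real {ω | x < X ω ∧ y < Y ω}

/-- The two-variate limit `x ∧ y → ∞`: both coordinates tend to infinity, in an arbitrary way. -/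
def bothToInfty : Filter (ℝ × ℝ) := atTop ×ˢ atTop

/-- The distribution of `X` is regularly varying with index `α`. A vanishing tail is excluded,
since the ratio at `t = 1` has to tend to `1`. -/
def RegVar (μ : Measure Ω) (X : Ω → ℝ) (α : ℝ) : Prop :=
  ∀ t : ℝ, 0 < t →
    Tendsto (fun x : ℝ => tail μ X (t * x) / tail μ X x) atTop (𝓝 (t ^ (-α)))

/-- The pair `(X, Y)` is two-variate regularly varying with indices `α₁`, `α₂`. -/
structure RegVar2 (μ : Measure Ω) (X Y : Ω → ℝ) (α₁ α₂ : ℝ) : Prop where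
  left : RegVar μ X α₁
  right : RegVar μ Y α₂
  joint : ∀ t₁ t₂ : ℝ, 0 < t₁ → 0 < t₂ →
    Tendsto (fun p : ℝ × ℝ => jointTail μ X Y (t₁ * p.1) (t₂ * p.2) / jointTail μ X Y p.1 p.2)
      bothToInfty (𝓝 (t₁ ^ (-α₁) * t₂ ^ (-α₂)))

/-- Generalized quasi asymptotic independence of two finite sequences. -/
structure GQAI {n m : ℕ} (μ : Measure Ω) (X : Fin n → Ω → ℝ) (Y : Fin m → Ω → ℝ) : Prop where
  left : ∀ i k : Fin n, ∀ j : Fin m, i ≠ k →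
    Tendsto (fun p : ℝ × ℝ =>
        μ.real {ω | p.1 < |X i ω| ∧ p.1 < X k ω ∧ p.2 < Y j ω} /
          (jointTail μ (X i) (Y j) p.1 p.2 + jointTail μ (X k) (Y j) p.1 p.2))
      bothToInfty (𝓝 0)
  right : ∀ j k : Fin m, ∀ i : Fin n, j ≠ k →
    Tendsto (fun p : ℝ × ℝ =>
        μ.real {ω | p.2 < |Y j ω| ∧ p.2 < Y k ω ∧ p.1 < X i ω} /
          (jointTail μ (X i) (Y j) p.1 p.2 + jointTail μ (X i) (Y k) p.1 p.2))
      bothToInfty (𝓝 0)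

/-- Generalized tail asymptotic independence of two finite sequences: the three thresholds
`q = (q₁, q₂, q₃)` tend to infinity independently of each other. -/
structure GTAI {n m : ℕ} (μ : Measure Ω) (X : Fin n → Ω → ℝ) (Y : Fin m → Ω → ℝ) : Prop where
  left : ∀ i k : Fin n, ∀ j : Fin m, i ≠ k →
    Tendsto (fun q : ℝ × ℝ × ℝ =>
        μ[{ω | q.1 < |X i ω|} | {ω | q.2.1 < X k ω ∧ q.2.2 < Y j ω}])
      (atTop ×ˢ atTop ×ˢ atTop) (𝓝 0)
  right : ∀ j k : Fin m, ∀ i : Fin n, j ≠ k →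
    Tendsto (fun q : ℝ × ℝ × ℝ =>
        μ[{ω | q.1 < |Y j ω|} | {ω | q.2.1 < Y k ω ∧ q.2.2 < X i ω}])
      (atTop ×ˢ atTop ×ˢ atTop) (𝓝 0)

/-- Tail asymptotic independence of one finite sequence. -/
def TAI {n : ℕ} (μ : Measure Ω) (X : Fin n → Ω → ℝ) : Prop :=
  ∀ i j : Fin n, i ≠ j →
    Tendsto (fun p : ℝ × ℝ => μ[{ω | p.1 < |X i ω|} | {ω | p.2 < X j ω}])
      bothToInfty (𝓝 0)

/-- The upper Matuszewska index `inf_{v > 1} (- ln F_*(v) / ln v)`, where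
`F_*(v) = liminf_{x → ∞} P[X > v x] / P[X > x]`; it is `+∞` when all `F_*(v)` vanish. -/
def upperMatuszewska (μ : Measure Ω) (X : Ω → ℝ) : EReal :=
  ⨅ v : Set.Ioi (1 : ℝ),
    -(ENNReal.log (liminf (fun x : ℝ => μ {ω | v * x < X ω} / μ {ω | x < X ω}) atTop)) /
      ((Real.log v : ℝ) : EReal)

/-- The condition on the weights `(Θ, Δ)` of a pair `(X, Y)`. The phrase "`x → ∞` and `y` is free"
is the filter `atTop ×ˢ ⊤`: the limit in `x` is uniform with respect to `y`. -/
def WeightCondition (μ : Measure Ω) (X Y Θ Δ : Ω → ℝ) : Prop :=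
  (∃ b : ℝ → ℝ, (∀ x, 0 ≤ x → 0 < b x) ∧ Tendsto b atTop atTop ∧
    (b =o[atTop] fun x : ℝ => x) ∧
    (fun p : ℝ × ℝ => μ.real {ω | b p.1 < Θ ω}) =o[atTop ×ˢ (⊤ : Filter ℝ)]
      (fun p : ℝ × ℝ => jointTail μ (fun ω => Θ ω * X ω) (fun ω => Δ ω * Y ω) p.1 p.2)) ∧
  (∃ c : ℝ → ℝ, (∀ y, 0 ≤ y → 0 < c y) ∧ Tendsto c atTop atTop ∧
    (c =o[atTop] fun y : ℝ => y) ∧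
    (fun p : ℝ × ℝ => μ.real {ω | c p.2 < Δ ω}) =o[(⊤ : Filter ℝ) ×ˢ atTop]
      (fun p : ℝ × ℝ => jointTail μ (fun ω => Θ ω * X ω) (fun ω => Δ ω * Y ω) p.1 p.2))

/-- The hypotheses shared by both parts: main variables `X_i`, `Y_j`, all pairs of which are
two-variate regularly varying, and weights `Θ_i`, `Δ_j`, arbitrarily dependent among themselves. -/
structure Setting {n m : ℕ} (μ : Measure Ω) (X Θ : Fin n → Ω → ℝ) (Y Δ : Fin m → Ω → ℝ)
    (α₁ α₂ : ℝ) : Prop where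
  measurable_X : ∀ i, Measurable (X i)
  measurable_Y : ∀ j, Measurable (Y j)
  measurable_Θ : ∀ i, Measurable (Θ i)
  measurable_Δ : ∀ j, Measurable (Δ j)
  regVar : ∀ i j, RegVar2 μ (X i) (Y j) α₁ α₂
  nonneg_Θ : ∀ i, ∀ᵐ ω ∂μ, 0 ≤ Θ i ω
  nonneg_Δ : ∀ j, ∀ᵐ ω ∂μ, 0 ≤ Δ j ω
  nondegenerate_Θ : ∀ i, ¬ ∀ᵐ ω ∂μ, Θ i ω = 0
  nondegenerate_Δ : ∀ j, ¬ ∀ᵐ ω ∂μ, Δ j ω = 0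
  indep : IndepFun (fun ω => ((fun i => Θ i ω), (fun j => Δ j ω)))
    (fun ω => ((fun i => X i ω), (fun j => Y j ω))) μ
  weights : ∀ i j, WeightCondition μ (X i) (Y j) (Θ i) (Δ j)
  moment : ∀ i j, ∃ ε : ℝ, 0 < ε ∧
    Integrable (fun ω => Θ i ω ^ (α₁ + ε) * Δ j ω ^ (α₂ + ε)) μ

/-- The weighted sum `Σ_i Θ_i X_i`. -/
def weightedSum {n : ℕ} (Θ X : Fin n → Ω → ℝ) (ω : Ω) : ℝ :=
  ∑ i, Θ i ω * X i ω

/-- The maximum of the partial sums `Σ_{i ≤ k} Θ_i X_i`, over all `k`. -/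
def maxPartialSum {n : ℕ} (Θ X : Fin n → Ω → ℝ) (ω : Ω) : ℝ :=
  ⨆ k : Fin n, ∑ i ∈ Finset.Iic k, Θ i ω * X i ω

/-- The maximum of the terms `Θ_i X_i`. -/
def maxTerm {n : ℕ} (Θ X : Fin n → Ω → ℝ) (ω : Ω) : ℝ :=
  ⨆ i : Fin n, Θ i ω * X i ω

/-- `Σ_i Σ_j E[Θ_i^α₁ Δ_j^α₂] P[X_i > x, Y_j > y]`. -/
def limitTail {n m : ℕ} (μ : Measure Ω) (X Θ : Fin n → Ω → ℝ) (Y Δ : Fin m → Ω → ℝ)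
    (α₁ α₂ x y : ℝ) : ℝ :=
  ∑ i, ∑ j, (∫ ω, Θ i ω ^ α₁ * Δ j ω ^ α₂ ∂μ) * jointTail μ (X i) (Y j) x y

end WeightedTails

end

/-!
The weight condition forces the weights to be bounded: in `P[Θ > b(x)] = o(P[Θ X > x, Δ Y > y])` the
limit is uniform in `y`, and for a fixed large `x` the right-hand side tends to `0` as `y → ∞`
(`WeightCondition.ae_bounded_left`). For bounded weights a bivariate Breiman lemma,
`RegVar2.tendsto_weighted`, follows from independence and dominated convergence: the joint tail of
`(Θ X, Δ Y)` is asymptotic to `E[Θ^α₁ Δ^α₂]` times that of `(X, Y)`. This moment may vanish, because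
`Θ` and `Δ` may have disjoint supports; the joint tail of the weighted pair then vanishes too, so
that all error terms can be measured relative to the moment times the joint tail.

The sums then obey the principle of a single big jump. The sum, the maximum of the partial sums and
the maximum of the terms have two properties in common (`IsSingleJumpFunctional`): they are at most
the sum of the positive parts, and they exceed `x` if one term exceeds `x` by a margin and all other
terms are small. Hence their joint excess event is, up to events on which two terms of the same
sequence are large simultaneously with a term of the other one, between the unions over `(i, j)` of
the excess events of the pairs `(Θ_i X_i, Δ_j Y_j)` at thresholds rescaled by factors close to `1`
(`jointTail_le_sum_add_crossSet`, `sum_sub_crossSet_le_jointTail`). The exceptional events are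
negligible by generalized quasi asymptotic independence (`cross_term_isLittleO`), so all these joint
tails are equivalent to the same sum (`Setting.jointTail_isEquivalent_limitTail`). The second part
reduces to this since generalized tail asymptotic independence, on the diagonal of the thresholds of
one sequence, implies the quasi version (`GTAI.gqai`).
-/

namespace WeightedTails

variable {Ω : Type*}

/-! ### Sums, maxima of partial sums and maxima of terms -/

/-- A functional `Z` of the terms `t 1, …, t n` that a single big jump determines: it is at most
the sum of the positive parts of the terms, and it exceeds `x` as soon as one of the terms exceeds
`x` by a margin `n η x`, with all the other ones at most `η x` in absolute value. -/
structure IsSingleJumpFunctional {n : ℕ} (t : Fin n → Ω → ℝ) (Z : Ω → ℝ) : Prop where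
  le_sum : ∀ ω, Z ω ≤ ∑ i, max (t i ω) 0
  lt_of_jump : ∀ ω x η i, 0 < x → 0 < η → (1 + n * η) * x < t i ω →
    (∀ k, k ≠ i → |t k ω| ≤ η * x) → x < Z ω

lemma sum_le_sum_max_zero {n : ℕ} (a : Fin n → ℝ) (s : Finset (Fin n)) :
    ∑ i ∈ s, a i ≤ ∑ i, max (a i) 0 :=
  (Finset.sum_le_sum fun _ _ => le_max_left _ _).trans
    (Finset.sum_le_sum_of_subset_of_nonneg (Finset.subset_univ s) fun _ _ _ => le_max_right _ _)

lemma isSingleJumpFunctional_weightedSum {n : ℕ} (Θ X : Fin n → Ω → ℝ) :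
    IsSingleJumpFunctional (fun i ω => Θ i ω * X i ω) (weightedSum Θ X) where
  le_sum ω := sum_le_sum_max_zero (fun i => Θ i ω * X i ω) Finset.univ
  lt_of_jump ω x η i hx hη hi hk := by
    have hle : ∑ k, (-(η * x) + if k = i then Θ i ω * X i ω + η * x else 0) ≤
        ∑ k, Θ k ω * X k ω := by
      refine Finset.sum_le_sum fun k _ => ?_
      split_ifs with hki
      · subst hki; linarith
      · linarith [(abs_le.1 (hk k hki)).1]
    rw [Finset.sum_add_distrib, Finset.sum_ite_eq' Finset.univ i] at hle
    simp only [Finset.sum_const, Finset.card_univ, Fintype.card_fin, nsmul_eq_mul,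
      Finset.mem_univ, if_true] at hle
    have := mul_pos hη hx
    unfold weightedSum
    linarith

lemma weightedSum_le_maxPartialSum {n : ℕ} (hn : 0 < n) (Θ X : Fin n → Ω → ℝ) (ω : Ω) :
    weightedSum Θ X ω ≤ maxPartialSum Θ X ω := by
  have h := le_ciSup (f := fun k : Fin n => ∑ i ∈ Finset.Iic k, Θ i ω * X i ω)
    (Set.finite_range _).bddAbove ⟨n - 1, by omega⟩
  have huniv : Finset.Iic (⟨n - 1, by omega⟩ : Fin n) = Finset.univ := by
    ext i
    simp only [Finset.mem_Iic, Finset.mem_univ, iff_true, Fin.le_def]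
    omega
  simp only [huniv] at h
  exact h

lemma isSingleJumpFunctional_maxPartialSum {n : ℕ} (hn : 0 < n) (Θ X : Fin n → Ω → ℝ) :
    IsSingleJumpFunctional (fun i ω => Θ i ω * X i ω) (maxPartialSum Θ X) where
  le_sum ω := by
    have : Nonempty (Fin n) := ⟨⟨0, hn⟩⟩
    exact ciSup_le fun k => sum_le_sum_max_zero (fun i => Θ i ω * X i ω) _
  lt_of_jump ω x η i hx hη hi hk :=
    ((isSingleJumpFunctional_weightedSum Θ X).lt_of_jump ω x η i hx hη hi hk).trans_le
      (weightedSum_le_maxPartialSum hn Θ X ω)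

lemma isSingleJumpFunctional_maxTerm {n : ℕ} (hn : 0 < n) (Θ X : Fin n → Ω → ℝ) :
    IsSingleJumpFunctional (fun i ω => Θ i ω * X i ω) (maxTerm Θ X) where
  le_sum ω := by
    have : Nonempty (Fin n) := ⟨⟨0, hn⟩⟩
    exact ciSup_le fun k => by
      simpa using sum_le_sum_max_zero (fun i => Θ i ω * X i ω) {k}
  lt_of_jump ω x η i hx hη hi _ := by
    have h := le_ciSup (f := fun i : Fin n => Θ i ω * X i ω) (Set.finite_range _).bddAbove i
    have h0 : 0 ≤ n * η * x := by positivity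
    unfold maxTerm
    linarith

variable [MeasurableSpace Ω]

/-! ### Elementary facts on tails -/

instance : bothToInfty.IsCountablyGenerated := by
  unfold bothToInfty; infer_instance

lemma eventually_bothToInfty_pos : ∀ᶠ p : ℝ × ℝ in bothToInfty, 0 < p.1 ∧ 0 < p.2 :=
  (eventually_gt_atTop 0).prod_mk (eventually_gt_atTop 0)

lemma tendsto_scale_bothToInfty {s t : ℝ} (hs : 0 < s) (ht : 0 < t) :
    Tendsto (fun p : ℝ × ℝ => (s * p.1, t * p.2)) bothToInfty bothToInfty :=
  (tendsto_id.const_mul_atTop hs).prodMap (tendsto_id.const_mul_atTop ht)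

lemma tendsto_swap_bothToInfty : Tendsto Prod.swap bothToInfty bothToInfty :=
  tendsto_prod_swap

lemma jointTail_nonneg (μ : Measure Ω) (U V : Ω → ℝ) (x y : ℝ) : 0 ≤ jointTail μ U V x y :=
  measureReal_nonneg

lemma jointTail_comm (μ : Measure Ω) (U V : Ω → ℝ) (x y : ℝ) :
    jointTail μ U V x y = jointTail μ V U y x := by
  simp only [jointTail, and_comm]

lemma measurableSet_jointExcess {U V : Ω → ℝ} (hU : Measurable U) (hV : Measurable V) (x y : ℝ) :
    MeasurableSet {ω | x < U ω ∧ y < V ω} :=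
  (measurableSet_lt measurable_const hU).inter (measurableSet_lt measurable_const hV)

lemma tendsto_tail_atTop (μ : Measure Ω) [IsFiniteMeasure μ] {U : Ω → ℝ} (hU : Measurable U) :
    Tendsto (tail μ U) atTop (𝓝 0) := by
  have h : Tendsto (fun x => μ {ω | x < U ω}) atTop (𝓝 (μ (⋂ x : ℝ, {ω | x < U ω}))) :=
    tendsto_measure_iInter_atTop
      (fun x => (measurableSet_lt measurable_const hU).nullMeasurableSet)
      (fun x y hxy ω (hω : y < U ω) => lt_of_le_of_lt hxy hω) ⟨0, measure_ne_top _ _⟩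
  have h0 : (⋂ x : ℝ, {ω | x < U ω}) = ∅ := by
    ext ω
    simp only [Set.mem_iInter, Set.mem_ofPred_eq, Set.mem_empty_iff_false, iff_false, not_forall]
    exact ⟨U ω, lt_irrefl _⟩
  rw [h0, measure_empty] at h
  exact (ENNReal.tendsto_toReal ENNReal.zero_ne_top).comp h

/-- The joint tail of a regularly varying pair is eventually positive: the ratio with
`t₁ = t₂ = 1` tends to `1`, whereas a quotient by a vanishing joint tail is `0`. -/
lemma RegVar2.eventually_pos {μ : Measure Ω} {U V : Ω → ℝ} {α β : ℝ} (h : RegVar2 μ U V α β) :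
    ∀ᶠ p : ℝ × ℝ in bothToInfty, 0 < jointTail μ U V p.1 p.2 := by
  have h1 := h.joint 1 1 one_pos one_pos
  simp only [Real.one_rpow, mul_one] at h1
  filter_upwards [h1.eventually (lt_mem_nhds one_pos)] with p hp
  refine (jointTail_nonneg μ U V p.1 p.2).lt_of_ne fun h0 => ?_
  simp [← h0] at hp

lemma RegVar2.symm {μ : Measure Ω} {U V : Ω → ℝ} {α β : ℝ} (h : RegVar2 μ U V α β) :
    RegVar2 μ V U β α where
  left := h.right
  right := h.left
  joint t₁ t₂ ht₁ ht₂ := by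
    have h1 := (h.joint t₂ t₁ ht₂ ht₁).comp tendsto_swap_bothToInfty
    refine (mul_comm (t₂ ^ (-α)) (t₁ ^ (-β)) ▸ h1).congr fun p => ?_
    simp only [Function.comp, Prod.fst_swap, Prod.snd_swap]
    rw [jointTail_comm μ U V, jointTail_comm μ U V]

/-- A rescaling of the thresholds changes the joint tail of a regularly varying pair by at most a
bounded factor. -/
lemma RegVar2.isBigO_scale {μ : Measure Ω} {U V : Ω → ℝ} {α β : ℝ} (h : RegVar2 μ U V α β)
    {s t : ℝ} (hs : 0 < s) (ht : 0 < t) :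
    (fun p : ℝ × ℝ => jointTail μ U V (s * p.1) (t * p.2)) =O[bothToInfty]
      fun p => jointTail μ U V p.1 p.2 := by
  refine isBigO_of_div_tendsto_nhds ?_ _ (h.joint s t hs ht)
  filter_upwards [h.eventually_pos] with p hp h0
  exact absurd h0 hp.ne'

/-! ### The weights are almost surely bounded -/

/-- The right-hand side of the first weight condition tends to `0` as `y → ∞` with `x` fixed, so
uniformity in `y` forces `P[Θ > b(x)] = 0` as soon as `x` is large. -/
lemma WeightCondition.ae_bounded_left {μ : Measure Ω} [IsFiniteMeasure μ] {X Y Θ Δ : Ω → ℝ}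
    (h : WeightCondition μ X Y Θ Δ) (hY : Measurable Y) (hΔ : Measurable Δ) :
    ∃ M, ∀ᵐ ω ∂μ, Θ ω ≤ M := by
  obtain ⟨⟨b, -, -, -, hb⟩, -⟩ := h
  have h1 := hb.bound one_pos
  rw [prod_top, eventually_comap] at h1
  obtain ⟨x, hx⟩ := h1.exists
  refine ⟨b x, ?_⟩
  have h2 : μ.real {ω | b x < Θ ω} ≤ 0 := by
    refine ge_of_tendsto (tendsto_tail_atTop μ (hΔ.mul hY)) (Eventually.of_forall fun y => ?_)
    have h3 := hx (x, y) rfl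
    rw [one_mul, Real.norm_of_nonneg measureReal_nonneg,
      Real.norm_of_nonneg (jointTail_nonneg _ _ _ _ _)] at h3
    exact h3.trans (measureReal_mono fun ω hω => hω.2)
  have h3 : μ {ω | b x < Θ ω} = 0 :=
    (measureReal_eq_zero_iff).1 (le_antisymm h2 measureReal_nonneg)
  rw [ae_iff]
  simpa only [not_le] using h3

lemma WeightCondition.symm {μ : Measure Ω} {X Y Θ Δ : Ω → ℝ} (h : WeightCondition μ X Y Θ Δ) :
    WeightCondition μ Y X Δ Θ := by
  obtain ⟨⟨b, hb₁, hb₂, hb₃, hb⟩, ⟨c, hc₁, hc₂, hc₃, hc⟩⟩ := h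
  exact ⟨⟨c, hc₁, hc₂, hc₃, (hc.comp_tendsto tendsto_prod_swap).congr (fun _ => rfl)
      fun _ => jointTail_comm μ _ _ _ _⟩,
    ⟨b, hb₁, hb₂, hb₃, (hb.comp_tendsto tendsto_prod_swap).congr (fun _ => rfl)
      fun _ => jointTail_comm μ _ _ _ _⟩⟩

/-! ### Joint tails of weighted pairs -/

lemma jointTail_mul_eq_integral {μ : Measure Ω} [IsProbabilityMeasure μ] {U V A B : Ω → ℝ}
    (hU : Measurable U) (hV : Measurable V) (hA : Measurable A) (hB : Measurable B)
    (hind : IndepFun (fun ω => (A ω, B ω)) (fun ω => (U ω, V ω)) μ) (x y : ℝ) :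
    jointTail μ (fun ω => A ω * U ω) (fun ω => B ω * V ω) x y =
      ∫ ω', jointTail μ (fun ω => A ω' * U ω) (fun ω => B ω' * V ω) x y ∂μ := by
  set S : Set ((ℝ × ℝ) × (ℝ × ℝ)) := {q | x < q.1.1 * q.2.1 ∧ y < q.1.2 * q.2.2}
  have hS : MeasurableSet S :=
    measurableSet_jointExcess (U := fun q : (ℝ × ℝ) × (ℝ × ℝ) => q.1.1 * q.2.1)
      (V := fun q => q.1.2 * q.2.2) (by fun_prop) (by fun_prop) x y
  have hUV : Measurable fun ω => (U ω, V ω) := hU.prodMk hV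
  have hAB : Measurable fun ω => (A ω, B ω) := hA.prodMk hB
  have hprod := (indepFun_iff_map_prod_eq_prod_map_map hAB.aemeasurable hUV.aemeasurable).1 hind
  have : IsProbabilityMeasure (μ.map fun ω => (U ω, V ω)) :=
    Measure.isProbabilityMeasure_map hUV.aemeasurable
  have hsec : Measurable fun z : ℝ × ℝ => (μ.map fun ω => (U ω, V ω)) (Prod.mk z ⁻¹' S) :=
    measurable_measure_prodMk_left hS
  have h1 : μ {ω | x < A ω * U ω ∧ y < B ω * V ω} =
      ∫⁻ ω', μ {ω | x < A ω' * U ω ∧ y < B ω' * V ω} ∂μ := by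
    have h2 : μ {ω | x < A ω * U ω ∧ y < B ω * V ω} =
        (μ.map fun ω => ((A ω, B ω), (U ω, V ω))) S :=
      (Measure.map_apply (hAB.prodMk hUV) hS).symm
    rw [h2, hprod, Measure.prod_apply hS, lintegral_map hsec hAB]
    refine lintegral_congr fun ω' => ?_
    rw [Measure.map_apply hUV (measurable_prodMk_left hS)]
    rfl
  have hmeas : Measurable fun ω' => μ {ω | x < A ω' * U ω ∧ y < B ω' * V ω} := by
    convert! hsec.comp hAB using 2 with ω'
    simp only [Function.comp]
    rw [Measure.map_apply hUV (measurable_prodMk_left hS)]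
    rfl
  simp only [jointTail, measureReal_def]
  rw [h1, integral_toReal hmeas.aemeasurable (Eventually.of_forall fun _ => measure_lt_top _ _)]

lemma jointTail_const_mul {μ : Measure Ω} {U V : Ω → ℝ} {a b : ℝ} (ha : 0 < a) (hb : 0 < b)
    (x y : ℝ) :
    jointTail μ (fun ω => a * U ω) (fun ω => b * V ω) x y =
      jointTail μ U V (a⁻¹ * x) (b⁻¹ * y) := by
  simp only [jointTail, inv_mul_lt_iff₀ ha, inv_mul_lt_iff₀ hb]

/-- A positive threshold is exceeded only by a positive `u`, so a weight may be replaced by an upper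
bound of it. -/
lemma lt_mul_of_lt_weight_mul {a M u x : ℝ} (ha : 0 ≤ a) (haM : a ≤ M) (hx : 0 < x)
    (h : x < a * u) : x < M * u := by
  have hu : 0 < u := pos_of_mul_pos_right (hx.trans h) ha
  exact h.trans_le (mul_le_mul_of_nonneg_right haM hu.le)

lemma pos_of_lt_weight_mul {a u x : ℝ} (ha : 0 ≤ a) (hx : 0 < x) (h : x < a * u) : 0 < a :=
  ha.lt_of_ne fun h0 => by simp [← h0] at h; linarith

lemma RegVar2.tendsto_const_mul {μ : Measure Ω} {U V : Ω → ℝ} {α β : ℝ}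
    (h : RegVar2 μ U V α β) (hα : 0 < α) (hβ : 0 < β) {a b : ℝ} (ha : 0 ≤ a) (hb : 0 ≤ b) :
    Tendsto (fun p : ℝ × ℝ => jointTail μ (fun ω => a * U ω) (fun ω => b * V ω) p.1 p.2 /
      jointTail μ U V p.1 p.2) bothToInfty (𝓝 (a ^ α * b ^ β)) := by
  by_cases hab : a = 0 ∨ b = 0
  · have h0 : a ^ α * b ^ β = 0 := by
      rcases hab with rfl | rfl
      · rw [Real.zero_rpow hα.ne', zero_mul]
      · rw [Real.zero_rpow hβ.ne', mul_zero]
    rw [h0]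
    refine tendsto_const_nhds.congr' ?_
    filter_upwards [eventually_bothToInfty_pos] with p hp
    have hs : {ω | p.1 < a * U ω ∧ p.2 < b * V ω} = ∅ := by
      refine Set.eq_empty_of_forall_notMem fun ω hω => ?_
      have h1 := pos_of_lt_weight_mul ha hp.1 hω.1
      have h2 := pos_of_lt_weight_mul hb hp.2 hω.2
      rcases hab with h | h <;> linarith
    simp [jointTail, hs]
  · push Not at hab
    have ha' := ha.lt_of_ne' hab.1
    have hb' := hb.lt_of_ne' hab.2
    have h1 := h.joint a⁻¹ b⁻¹ (inv_pos.2 ha') (inv_pos.2 hb')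
    rw [Real.inv_rpow ha, Real.inv_rpow hb, Real.rpow_neg ha, Real.rpow_neg hb, inv_inv,
      inv_inv] at h1
    simpa only [jointTail_const_mul ha' hb'] using h1

/-- Bivariate Breiman lemma for bounded weights: by independence the normalized joint tail of the
weighted pair is an average over the weights, and dominated convergence applies. -/
lemma RegVar2.tendsto_weighted {μ : Measure Ω} [IsProbabilityMeasure μ] {U V A B : Ω → ℝ}
    {α β M : ℝ} (h : RegVar2 μ U V α β) (hα : 0 < α) (hβ : 0 < β)
    (hU : Measurable U) (hV : Measurable V) (hA : Measurable A) (hB : Measurable B)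
    (hind : IndepFun (fun ω => (A ω, B ω)) (fun ω => (U ω, V ω)) μ)
    (hA0 : ∀ᵐ ω ∂μ, 0 ≤ A ω) (hB0 : ∀ᵐ ω ∂μ, 0 ≤ B ω)
    (hAM : ∀ᵐ ω ∂μ, A ω ≤ M) (hBM : ∀ᵐ ω ∂μ, B ω ≤ M) (hM : 0 < M) :
    Tendsto (fun p : ℝ × ℝ =>
        jointTail μ (fun ω => A ω * U ω) (fun ω => B ω * V ω) p.1 p.2 / jointTail μ U V p.1 p.2)
      bothToInfty (𝓝 (∫ ω, A ω ^ α * B ω ^ β ∂μ)) := by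
  have heq : ∀ p : ℝ × ℝ,
      jointTail μ (fun ω => A ω * U ω) (fun ω => B ω * V ω) p.1 p.2 / jointTail μ U V p.1 p.2 =
      ∫ ω', jointTail μ (fun ω => A ω' * U ω) (fun ω => B ω' * V ω) p.1 p.2 /
        jointTail μ U V p.1 p.2 ∂μ := fun p => by
    rw [integral_div, jointTail_mul_eq_integral hU hV hA hB hind]
  simp only [heq]
  have hlim := h.tendsto_const_mul hα hβ hM.le hM.le
  refine tendsto_integral_filter_of_dominated_convergence (fun _ => M ^ α * M ^ β + 1)
    (Eventually.of_forall fun p => ?_) ?_ (integrable_const _) ?_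
  · have hmeas : Measurable fun z : Ω => μ (Prod.mk z ⁻¹'
        {q : Ω × Ω | p.1 < A q.1 * U q.2 ∧ p.2 < B q.1 * V q.2}) :=
      measurable_measure_prodMk_left
        (measurableSet_jointExcess (U := fun q : Ω × Ω => A q.1 * U q.2)
          (V := fun q => B q.1 * V q.2) (by fun_prop) (by fun_prop) p.1 p.2)
    exact (hmeas.ennreal_toReal.div_const _).aestronglyMeasurable
  · filter_upwards [eventually_bothToInfty_pos, hlim.eventually (gt_mem_nhds (lt_add_one _))]
      with p hp hpM
    filter_upwards [hA0, hB0, hAM, hBM] with ω' hA0 hB0 hAM hBM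
    rw [Real.norm_of_nonneg (div_nonneg (jointTail_nonneg _ _ _ _ _) (jointTail_nonneg _ _ _ _ _))]
    refine le_trans ?_ hpM.le
    refine div_le_div_of_nonneg_right ?_ (jointTail_nonneg _ _ _ _ _)
    exact measureReal_mono fun ω hω => ⟨lt_mul_of_lt_weight_mul hA0 hAM hp.1 hω.1,
      lt_mul_of_lt_weight_mul hB0 hBM hp.2 hω.2⟩
  · filter_upwards [hA0, hB0] with ω' hA0 hB0
    exact h.tendsto_const_mul hα hβ hA0 hB0

lemma integrable_rpow_mul_rpow {μ : Measure Ω} [IsFiniteMeasure μ] {A B : Ω → ℝ} {α β M : ℝ}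
    (hα : 0 ≤ α) (hβ : 0 ≤ β) (hA : Measurable A) (hB : Measurable B)
    (hA0 : ∀ᵐ ω ∂μ, 0 ≤ A ω) (hB0 : ∀ᵐ ω ∂μ, 0 ≤ B ω)
    (hAM : ∀ᵐ ω ∂μ, A ω ≤ M) (hBM : ∀ᵐ ω ∂μ, B ω ≤ M) :
    Integrable (fun ω => A ω ^ α * B ω ^ β) μ := by
  refine Integrable.of_bound (by fun_prop) (M ^ α * M ^ β) ?_
  filter_upwards [hA0, hB0, hAM, hBM] with ω hA0 hB0 hAM hBM
  rw [Real.norm_of_nonneg (by positivity)]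
  have hM := hA0.trans hAM
  gcongr

lemma integral_rpow_mul_rpow_nonneg {μ : Measure Ω} {A B : Ω → ℝ} {α β : ℝ}
    (hA0 : ∀ᵐ ω ∂μ, 0 ≤ A ω) (hB0 : ∀ᵐ ω ∂μ, 0 ≤ B ω) :
    0 ≤ ∫ ω, A ω ^ α * B ω ^ β ∂μ := by
  refine integral_nonneg_of_ae ?_
  filter_upwards [hA0, hB0] with ω hA0 hB0
  exact mul_nonneg (Real.rpow_nonneg hA0 _) (Real.rpow_nonneg hB0 _)

/-- If the moment vanishes, then the two weights are almost surely never positive together. -/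
lemma ae_not_pos_of_integral_eq_zero {μ : Measure Ω} [IsFiniteMeasure μ] {A B : Ω → ℝ} {α β M : ℝ}
    (hα : 0 ≤ α) (hβ : 0 ≤ β) (hA : Measurable A) (hB : Measurable B)
    (hA0 : ∀ᵐ ω ∂μ, 0 ≤ A ω) (hB0 : ∀ᵐ ω ∂μ, 0 ≤ B ω)
    (hAM : ∀ᵐ ω ∂μ, A ω ≤ M) (hBM : ∀ᵐ ω ∂μ, B ω ≤ M)
    (h0 : ∫ ω, A ω ^ α * B ω ^ β ∂μ = 0) : ∀ᵐ ω ∂μ, ¬ (0 < A ω ∧ 0 < B ω) := by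
  have h1 := (integral_eq_zero_iff_of_nonneg_ae (by
    filter_upwards [hA0, hB0] with ω hA0 hB0
    exact mul_nonneg (Real.rpow_nonneg hA0 _) (Real.rpow_nonneg hB0 _))
    (integrable_rpow_mul_rpow hα hβ hA hB hA0 hB0 hAM hBM)).1 h0
  filter_upwards [h1] with ω hω hpos
  exact (mul_pos (Real.rpow_pos_of_pos hpos.1 _) (Real.rpow_pos_of_pos hpos.2 _)).ne' hω

/-- The joint tail of the weighted pair at rescaled thresholds. The error is relative to the moment
times the joint tail of `(U, V)`, and hence it vanishes if the moment does. -/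
lemma RegVar2.weighted_scale_isLittleO {μ : Measure Ω} [IsProbabilityMeasure μ] {U V A B : Ω → ℝ}
    {α β M : ℝ} (h : RegVar2 μ U V α β) (hα : 0 < α) (hβ : 0 < β)
    (hU : Measurable U) (hV : Measurable V) (hA : Measurable A) (hB : Measurable B)
    (hind : IndepFun (fun ω => (A ω, B ω)) (fun ω => (U ω, V ω)) μ)
    (hA0 : ∀ᵐ ω ∂μ, 0 ≤ A ω) (hB0 : ∀ᵐ ω ∂μ, 0 ≤ B ω)
    (hAM : ∀ᵐ ω ∂μ, A ω ≤ M) (hBM : ∀ᵐ ω ∂μ, B ω ≤ M) (hM : 0 < M) {s : ℝ} (hs : 0 < s) :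
    (fun p : ℝ × ℝ =>
        jointTail μ (fun ω => A ω * U ω) (fun ω => B ω * V ω) (s * p.1) (s * p.2) -
        s ^ (-α) * s ^ (-β) * ((∫ ω, A ω ^ α * B ω ^ β ∂μ) * jointTail μ U V p.1 p.2))
      =o[bothToInfty] fun p => (∫ ω, A ω ^ α * B ω ^ β ∂μ) * jointTail μ U V p.1 p.2 := by
  set c := ∫ ω, A ω ^ α * B ω ^ β ∂μ with hc
  by_cases hc0 : c = 0
  · have hnull := ae_not_pos_of_integral_eq_zero hα.le hβ.le hA hB hA0 hB0 hAM hBM hc0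
    refine (isLittleO_zero (fun p : ℝ × ℝ => c * jointTail μ U V p.1 p.2) bothToInfty).congr' ?_
      EventuallyEq.rfl
    filter_upwards [eventually_bothToInfty_pos] with p hp
    have h0 : jointTail μ (fun ω => A ω * U ω) (fun ω => B ω * V ω) (s * p.1) (s * p.2) = 0 := by
      refine (measureReal_eq_zero_iff).2 (measure_mono_null ?_ (ae_iff.1 (hnull.and (hA0.and hB0))))
      intro ω hω hcon
      exact hcon.1 ⟨pos_of_lt_weight_mul hcon.2.1 (mul_pos hs hp.1) hω.1,
        pos_of_lt_weight_mul hcon.2.2 (mul_pos hs hp.2) hω.2⟩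
    simp [h0, hc0]
  · have h1 := (h.tendsto_weighted hα hβ hU hV hA hB hind hA0 hB0 hAM hBM hM).comp
      (tendsto_scale_bothToInfty hs hs)
    have h2 := (h1.mul (h.joint s s hs hs)).sub_const (s ^ (-α) * s ^ (-β) * c)
    rw [← hc, mul_comm c, sub_self] at h2
    refine (isLittleO_const_mul_right_iff hc0).2 ?_
    refine (isLittleO_iff_tendsto' ?_).2 (h2.congr' ?_)
    · filter_upwards [h.eventually_pos] with p hp h0
      exact absurd h0 hp.ne'
    · filter_upwards [h.eventually_pos,
        (tendsto_scale_bothToInfty hs hs).eventually h.eventually_pos] with p hp hps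
      simp only [Function.comp]
      have hp' := hp.ne'
      have hps' := hps.ne'
      field_simp

/-- A cross term, in which two of the weighted main variables of one sequence are large, is
negligible. If the three weights are almost surely never positive together, it is zero; otherwise
both moments are positive and the unweighted cross term controls it. -/
lemma cross_term_isLittleO {μ : Measure Ω} [IsProbabilityMeasure μ] {U V W A B C : Ω → ℝ}
    {α β M η : ℝ} (hUW : RegVar2 μ U W α β) (hVW : RegVar2 μ V W α β) (hα : 0 ≤ α) (hβ : 0 ≤ β)
    (hA : Measurable A) (hB : Measurable B) (hC : Measurable C)
    (hA0 : ∀ᵐ ω ∂μ, 0 ≤ A ω) (hB0 : ∀ᵐ ω ∂μ, 0 ≤ B ω) (hC0 : ∀ᵐ ω ∂μ, 0 ≤ C ω)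
    (hAM : ∀ᵐ ω ∂μ, A ω ≤ M) (hBM : ∀ᵐ ω ∂μ, B ω ≤ M) (hCM : ∀ᵐ ω ∂μ, C ω ≤ M)
    (hM : 0 < M) (hη : 0 < η)
    (hcross : Tendsto (fun p : ℝ × ℝ => μ.real {ω | p.1 < |U ω| ∧ p.1 < V ω ∧ p.2 < W ω} /
      (jointTail μ U W p.1 p.2 + jointTail μ V W p.1 p.2)) bothToInfty (𝓝 0)) :
    (fun p : ℝ × ℝ => μ.real {ω | η * p.1 < |A ω * U ω| ∧ η * p.1 < B ω * V ω ∧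
        η * p.2 < C ω * W ω}) =o[bothToInfty]
      fun p => (∫ ω, A ω ^ α * C ω ^ β ∂μ) * jointTail μ U W p.1 p.2 +
        (∫ ω, B ω ^ α * C ω ^ β ∂μ) * jointTail μ V W p.1 p.2 := by
  set a := ∫ ω, A ω ^ α * C ω ^ β ∂μ
  set b := ∫ ω, B ω ^ α * C ω ^ β ∂μ
  have ha0 : 0 ≤ a := integral_rpow_mul_rpow_nonneg hA0 hC0
  have hb0 : 0 ≤ b := integral_rpow_mul_rpow_nonneg hB0 hC0
  have hpos : ∀ {p : ℝ × ℝ}, 0 < p.1 ∧ 0 < p.2 → ∀ {ω}, 0 ≤ A ω → 0 ≤ B ω → 0 ≤ C ω →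
      η * p.1 < |A ω * U ω| → η * p.1 < B ω * V ω → η * p.2 < C ω * W ω →
      0 < A ω ∧ 0 < B ω ∧ 0 < C ω := by
    intro p hp ω hA hB hC h1 h2 h3
    rw [abs_mul, abs_of_nonneg hA] at h1
    exact ⟨pos_of_lt_weight_mul hA (mul_pos hη hp.1) h1,
      pos_of_lt_weight_mul hB (mul_pos hη hp.1) h2, pos_of_lt_weight_mul hC (mul_pos hη hp.2) h3⟩
  by_cases hab : a = 0 ∨ b = 0
  · have hnull : ∀ᵐ ω ∂μ, ¬ (0 < A ω ∧ 0 < B ω ∧ 0 < C ω) := by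
      rcases hab with h | h
      · filter_upwards [ae_not_pos_of_integral_eq_zero hα hβ hA hC hA0 hC0 hAM hCM h]
          with ω hω h using hω ⟨h.1, h.2.2⟩
      · filter_upwards [ae_not_pos_of_integral_eq_zero hα hβ hB hC hB0 hC0 hBM hCM h]
          with ω hω h using hω h.2
    refine (isLittleO_zero _ bothToInfty).congr' ?_ EventuallyEq.rfl
    filter_upwards [eventually_bothToInfty_pos] with p hp
    refine ((measureReal_eq_zero_iff).2 (measure_mono_null ?_
      (ae_iff.1 (hnull.and (hA0.and (hB0.and hC0)))))).symm
    intro ω hω hcon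
    exact hcon.1 (hpos hp hcon.2.1 hcon.2.2.1 hcon.2.2.2 hω.1 hω.2.1 hω.2.2)
  · push Not at hab
    have hs : 0 < M⁻¹ * η := mul_pos (inv_pos.2 hM) hη
    -- The unweighted cross term at thresholds `M⁻¹ η x`, `M⁻¹ η y` dominates the weighted one.
    have h1 : (fun p : ℝ × ℝ => μ.real {ω | p.1 < |U ω| ∧ p.1 < V ω ∧ p.2 < W ω}) =o[bothToInfty]
        fun p => jointTail μ U W p.1 p.2 + jointTail μ V W p.1 p.2 := by
      refine (isLittleO_iff_tendsto' ?_).2 hcross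
      filter_upwards [hUW.eventually_pos, hVW.eventually_pos] with p h1 h2 h0
      linarith
    have h2 := h1.comp_tendsto (tendsto_scale_bothToInfty hs hs)
    have hO : ∀ {f g : ℝ × ℝ → ℝ}, (∀ p, 0 ≤ f p) → (∀ p, 0 ≤ g p) →
        f =O[bothToInfty] fun p => f p + g p := fun hf hg =>
      isBigO_of_le _ fun p => by
        rw [Real.norm_of_nonneg (hf p), Real.norm_of_nonneg (add_nonneg (hf p) (hg p))]
        linarith [hg p]
    have hJ : ∀ {U W : Ω → ℝ} {c : ℝ}, 0 ≤ c → ∀ p : ℝ × ℝ, 0 ≤ c * jointTail μ U W p.1 p.2 :=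
      fun hc p => mul_nonneg hc (jointTail_nonneg _ _ _ _ _)
    have h3 : (fun p : ℝ × ℝ => jointTail μ U W (M⁻¹ * η * p.1) (M⁻¹ * η * p.2) +
        jointTail μ V W (M⁻¹ * η * p.1) (M⁻¹ * η * p.2)) =O[bothToInfty]
        fun p => a * jointTail μ U W p.1 p.2 + b * jointTail μ V W p.1 p.2 := by
      refine IsBigO.add ?_ ?_
      · exact ((isBigO_const_mul_right_iff hab.1).2 (hUW.isBigO_scale hs hs)).trans
          (hO (hJ ha0) (hJ hb0))
      · refine ((isBigO_const_mul_right_iff hab.2).2 (hVW.isBigO_scale hs hs)).trans ?_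
        exact (hO (hJ hb0) (hJ ha0)).congr_right fun p => add_comm _ _
    refine IsBigO.trans_isLittleO ?_ (h2.trans_isBigO h3)
    refine IsBigO.of_bound 1 ?_
    filter_upwards [eventually_bothToInfty_pos] with p hp
    simp only [Function.comp]
    rw [one_mul, Real.norm_of_nonneg measureReal_nonneg, Real.norm_of_nonneg measureReal_nonneg]
    refine ENNReal.toReal_mono (measure_ne_top _ _) (measure_mono_ae ?_)
    filter_upwards [hA0, hB0, hC0, hAM, hBM, hCM] with ω hA0 hB0 hC0 hAM hBM hCM hω
    obtain ⟨h1, h2, h3⟩ := hω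
    rw [abs_mul, abs_of_nonneg hA0] at h1
    have key : ∀ {d u x : ℝ}, 0 ≤ d → d ≤ M → 0 < x → η * x < d * u → M⁻¹ * η * x < u :=
      fun hd hdM hx h => by
        rw [mul_assoc, inv_mul_lt_iff₀ hM]
        exact lt_mul_of_lt_weight_mul hd hdM (mul_pos hη hx) h
    exact ⟨key hA0 hAM hp.1 h1, key hB0 hBM hp.1 h2, key hC0 hCM hp.2 h3⟩

/-! ### A single big jump -/

/-- The event that two different terms of the first sequence exceed `x`, one of them possibly
in absolute value only, and that some term of the second sequence exceeds `y`. -/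
def crossSet {n m : ℕ} (t : Fin n → Ω → ℝ) (u : Fin m → Ω → ℝ) (x y : ℝ) : Set Ω :=
  {ω | ∃ i k j, k ≠ i ∧ x < |t k ω| ∧ x < t i ω ∧ y < u j ω}

lemma exists_jump_of_lt_sum {n : ℕ} {a : Fin n → ℝ} {x η : ℝ} (hx : 0 < x) (hη : 0 < η)
    (hn : n * η ≤ 1) (h : x < ∑ i, max (a i) 0) :
    (∃ i, (1 - n * η) * x < a i) ∨ ∃ i k, k ≠ i ∧ η * x < a k ∧ η * x < a i := by
  by_contra! hcon
  obtain ⟨h1, h2⟩ := hcon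
  have hηx : 0 < η * x := mul_pos hη hx
  have hnx : 0 ≤ (1 - n * η) * x := mul_nonneg (by linarith) hx.le
  by_cases hbig : ∃ k, η * x < a k
  · obtain ⟨k, hk⟩ := hbig
    have hle : ∑ i, max (a i) 0 ≤ ∑ i, (η * x + if i = k then (1 - n * η) * x else 0) := by
      refine Finset.sum_le_sum fun i _ => ?_
      split_ifs with hik
      · exact max_le (by linarith [h1 i]) (by linarith)
      · exact max_le (by linarith [h2 i k (Ne.symm hik) hk]) (by linarith)
    rw [Finset.sum_add_distrib, Finset.sum_ite_eq' Finset.univ k] at hle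
    simp only [Finset.sum_const, Finset.card_univ, Fintype.card_fin, nsmul_eq_mul,
      Finset.mem_univ, if_true] at hle
    linarith
  · push Not at hbig
    have hle : ∑ i, max (a i) 0 ≤ ∑ _i : Fin n, η * x :=
      Finset.sum_le_sum fun i _ => max_le (hbig i) hηx.le
    simp only [Finset.sum_const, Finset.card_univ, Fintype.card_fin, nsmul_eq_mul] at hle
    linarith

lemma exists_lt_of_lt_sum {n : ℕ} {a : Fin n → ℝ} {x η : ℝ} (hx : 0 < x)
    (hn : n * η ≤ 1) (h : x < ∑ i, max (a i) 0) (hη : 0 < η) : ∃ i, η * x < a i := by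
  by_contra! hcon
  have hle : ∑ i, max (a i) 0 ≤ ∑ _i : Fin n, η * x :=
    Finset.sum_le_sum fun i _ => max_le (hcon i) (mul_pos hη hx).le
  simp only [Finset.sum_const, Finset.card_univ, Fintype.card_fin, nsmul_eq_mul] at hle
  have := mul_le_mul_of_nonneg_right hn hx.le
  linarith

lemma jointTail_le_sum_add_crossSet {n m : ℕ} {μ : Measure Ω} [IsFiniteMeasure μ]
    {t : Fin n → Ω → ℝ} {u : Fin m → Ω → ℝ} {Z W : Ω → ℝ}
    (hZ : IsSingleJumpFunctional t Z) (hW : IsSingleJumpFunctional u W)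
    {x y η : ℝ} (hx : 0 < x) (hy : 0 < y) (hη : 0 < η) (hN : (n + m) * η ≤ 1) :
    jointTail μ Z W x y ≤
      ∑ i, ∑ j, jointTail μ (t i) (u j) ((1 - (n + m) * η) * x) ((1 - (n + m) * η) * y) +
        (μ.real (crossSet t u (η * x) (η * y)) + μ.real (crossSet u t (η * y) (η * x))) := by
  have hn : n * η ≤ 1 := by
    have : 0 ≤ m * η := by positivity
    linarith
  have hm : m * η ≤ 1 := by
    have : 0 ≤ n * η := by positivity
    linarith
  have hnx : ∀ {z : ℝ}, 0 < z → (1 - (n + m) * η) * z ≤ (1 - n * η) * z := fun hz =>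
    mul_le_mul_of_nonneg_right (by nlinarith [Nat.cast_nonneg (α := ℝ) m]) hz.le
  have hmx : ∀ {z : ℝ}, 0 < z → (1 - (n + m) * η) * z ≤ (1 - m * η) * z := fun hz =>
    mul_le_mul_of_nonneg_right (by nlinarith [Nat.cast_nonneg (α := ℝ) n]) hz.le
  have hsub : {ω | x < Z ω ∧ y < W ω} ⊆
      (⋃ q : Fin n × Fin m, {ω | (1 - (n + m) * η) * x < t q.1 ω ∧
        (1 - (n + m) * η) * y < u q.2 ω}) ∪
      (crossSet t u (η * x) (η * y) ∪ crossSet u t (η * y) (η * x)) := by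
    rintro ω ⟨h1, h2⟩
    have h1' := h1.trans_le (hZ.le_sum ω)
    have h2' := h2.trans_le (hW.le_sum ω)
    obtain ⟨i₀, hi₀⟩ := exists_lt_of_lt_sum hx hn h1' hη
    obtain ⟨j₀, hj₀⟩ := exists_lt_of_lt_sum hy hm h2' hη
    rcases exists_jump_of_lt_sum hx hη hn h1' with ⟨i, hi⟩ | ⟨i, k, hik, hk, hi⟩
    · rcases exists_jump_of_lt_sum hy hη hm h2' with ⟨j, hj⟩ | ⟨j, l, hjl, hl, hj⟩
      · exact Or.inl (Set.mem_iUnion.2 ⟨(i, j), (hnx hx).trans_lt hi, (hmx hy).trans_lt hj⟩)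
      · exact Or.inr (Or.inr ⟨j, l, i₀, hjl, hl.trans_le (le_abs_self _), hj, hi₀⟩)
    · exact Or.inr (Or.inl ⟨i, k, j₀, hik, hk.trans_le (le_abs_self _), hi, hj₀⟩)
  refine (measureReal_mono hsub).trans ((measureReal_union_le _ _).trans ?_)
  refine add_le_add ((measureReal_iUnion_fintype_le _).trans_eq ?_) (measureReal_union_le _ _)
  rw [Fintype.sum_prod_type]
  rfl

lemma measurableSet_singleJump {n : ℕ} {t : Fin n → Ω → ℝ} (ht : ∀ i, Measurable (t i))
    (i : Fin n) (a b : ℝ) : MeasurableSet {ω | a < t i ω ∧ ∀ k, k ≠ i → |t k ω| ≤ b} := by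
  have : {ω | a < t i ω ∧ ∀ k, k ≠ i → |t k ω| ≤ b} =
      {ω | a < t i ω} ∩ ⋂ k, ⋂ (_ : k ≠ i), {ω | |t k ω| ≤ b} := by
    ext ω; simp
  rw [this]
  refine (measurableSet_lt measurable_const (ht i)).inter
    (MeasurableSet.iInter fun k => MeasurableSet.iInter fun _ => ?_)
  exact measurableSet_le (ht k).abs measurable_const

/-- The events that the jump occurs at `(i, j)` are disjoint for different pairs `(i, j)`, so their
probabilities add up. -/
lemma sum_sub_crossSet_le_jointTail {n m : ℕ} {μ : Measure Ω} [IsFiniteMeasure μ]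
    {t : Fin n → Ω → ℝ} {u : Fin m → Ω → ℝ} {Z W : Ω → ℝ}
    (ht : ∀ i, Measurable (t i)) (hu : ∀ j, Measurable (u j))
    (hZ : IsSingleJumpFunctional t Z) (hW : IsSingleJumpFunctional u W)
    {x y η : ℝ} (hx : 0 < x) (hy : 0 < y) (hη : 0 < η) (hη1 : η ≤ 1) :
    ∑ i, ∑ j, jointTail μ (t i) (u j) ((1 + (n + m) * η) * x) ((1 + (n + m) * η) * y) -
        n * m * (μ.real (crossSet t u (η * x) (η * y)) + μ.real (crossSet u t (η * y) (η * x))) ≤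
      jointTail μ Z W x y := by
  set s : ℝ := 1 + (n + m) * η with hs
  set e := μ.real (crossSet t u (η * x) (η * y)) + μ.real (crossSet u t (η * y) (η * x)) with he
  have hnm : (0 : ℝ) ≤ n * η ∧ (0 : ℝ) ≤ m * η := ⟨by positivity, by positivity⟩
  have hηs : ∀ {z : ℝ}, 0 < z → η * z ≤ s * z := fun hz =>
    mul_le_mul_of_nonneg_right (by rw [hs]; nlinarith [hnm.1, hnm.2]) hz.le
  let A : Fin n × Fin m → Set Ω := fun q =>
    {ω | s * x < t q.1 ω ∧ ∀ k, k ≠ q.1 → |t k ω| ≤ η * x} ∩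
      {ω | s * y < u q.2 ω ∧ ∀ l, l ≠ q.2 → |u l ω| ≤ η * y}
  have hAmeas : ∀ q, MeasurableSet (A q) := fun q =>
    (measurableSet_singleJump ht _ _ _).inter (measurableSet_singleJump hu _ _ _)
  have hdisj : Pairwise (Function.onFun Disjoint A) := by
    intro q r hqr
    refine Set.disjoint_left.2 fun ω hq hr => hqr ?_
    obtain ⟨⟨h1, -⟩, ⟨h2, -⟩⟩ := hq
    obtain ⟨⟨-, h3⟩, ⟨-, h4⟩⟩ := hr
    refine Prod.ext ?_ ?_
    · by_contra hne
      linarith [h3 _ hne, le_abs_self (t q.1 ω), hηs hx]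
    · by_contra hne
      linarith [h4 _ hne, le_abs_self (u q.2 ω), hηs hy]
  have hA : ∑ q, μ.real (A q) ≤ jointTail μ Z W x y := by
    rw [← measureReal_iUnion_fintype hdisj hAmeas]
    refine measureReal_mono (Set.iUnion_subset fun q ω hω => ?_)
    obtain ⟨⟨h1, h2⟩, ⟨h3, h4⟩⟩ := hω
    refine ⟨hZ.lt_of_jump ω x η q.1 hx hη (lt_of_le_of_lt ?_ h1) h2,
      hW.lt_of_jump ω y η q.2 hy hη (lt_of_le_of_lt ?_ h3) h4⟩
    · exact mul_le_mul_of_nonneg_right (by rw [hs]; nlinarith [hnm.2]) hx.le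
    · exact mul_le_mul_of_nonneg_right (by rw [hs]; nlinarith [hnm.1]) hy.le
  have hB : ∀ q : Fin n × Fin m, jointTail μ (t q.1) (u q.2) (s * x) (s * y) ≤
      μ.real (A q) + e := by
    intro q
    have hsub : {ω | s * x < t q.1 ω ∧ s * y < u q.2 ω} ⊆
        A q ∪ (crossSet t u (η * x) (η * y) ∪ crossSet u t (η * y) (η * x)) := by
      rintro ω ⟨h1, h2⟩
      by_cases h3 : ∀ k, k ≠ q.1 → |t k ω| ≤ η * x
      · by_cases h4 : ∀ l, l ≠ q.2 → |u l ω| ≤ η * y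
        · exact Or.inl ⟨⟨h1, h3⟩, ⟨h2, h4⟩⟩
        · push Not at h4
          obtain ⟨l, hl, hlt⟩ := h4
          exact Or.inr (Or.inr ⟨q.2, l, q.1, hl, hlt, (hηs hy).trans_lt h2, (hηs hx).trans_lt h1⟩)
      · push Not at h3
        obtain ⟨k, hk, hkt⟩ := h3
        exact Or.inr (Or.inl ⟨q.1, k, q.2, hk, hkt, (hηs hx).trans_lt h1, (hηs hy).trans_lt h2⟩)
    exact (measureReal_mono hsub).trans ((measureReal_union_le _ _).trans
      (add_le_add le_rfl (measureReal_union_le _ _)))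
  have hsum : ∑ q : Fin n × Fin m, jointTail μ (t q.1) (u q.2) (s * x) (s * y) ≤
      ∑ q, μ.real (A q) + n * m * e := by
    refine (Finset.sum_le_sum fun q _ => hB q).trans_eq ?_
    rw [Finset.sum_add_distrib]
    simp
  rw [Fintype.sum_prod_type] at hsum
  linarith

lemma crossSet_isLittleO {n m : ℕ} {μ : Measure Ω} [IsFiniteMeasure μ]
    {t : Fin n → Ω → ℝ} {u : Fin m → Ω → ℝ} {ι : Type*} {l : Filter ι} {f g L : ι → ℝ}
    (h : ∀ i k j, k ≠ i →
      (fun p => μ.real {ω | f p < |t k ω| ∧ f p < t i ω ∧ g p < u j ω}) =o[l] L) :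
    (fun p => μ.real (crossSet t u (f p) (g p))) =o[l] L := by
  have hsum : (fun p => ∑ q : Fin n × Fin n × Fin m,
      if q.2.1 ≠ q.1 then μ.real {ω | f p < |t q.2.1 ω| ∧ f p < t q.1 ω ∧ g p < u q.2.2 ω} else 0)
      =o[l] L := by
    refine IsLittleO.fun_sum fun q _ => ?_
    split_ifs with hq
    · exact h _ _ _ hq
    · exact isLittleO_zero _ _
  refine IsBigO.trans_isLittleO (IsBigO.of_bound 1 (Eventually.of_forall fun p => ?_) :
    (fun p => μ.real (crossSet t u (f p) (g p))) =O[l] _) hsum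
  rw [one_mul, Real.norm_of_nonneg measureReal_nonneg]
  refine le_trans ?_ (le_abs_self _)
  have hsub : crossSet t u (f p) (g p) ⊆ ⋃ q : Fin n × Fin n × Fin m,
      {ω | q.2.1 ≠ q.1 ∧ f p < |t q.2.1 ω| ∧ f p < t q.1 ω ∧ g p < u q.2.2 ω} := by
    rintro ω ⟨i, k, j, hω⟩
    exact Set.mem_iUnion.2 ⟨(i, k, j), hω⟩
  refine (measureReal_mono hsub).trans ((measureReal_iUnion_fintype_le _).trans ?_)
  refine Finset.sum_le_sum fun q _ => ?_
  split_ifs with hq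
  · exact measureReal_mono fun ω hω => hω.2
  · simp [hq]

/-! ### Asymptotics under generalized quasi asymptotic independence -/

section Setting

variable {μ : Measure Ω} {α₁ α₂ : ℝ} {n m : ℕ}
  {X Θ : Fin n → Ω → ℝ} {Y Δ : Fin m → Ω → ℝ}

lemma Setting.indepFun_pair (h : Setting μ X Θ Y Δ α₁ α₂) (i : Fin n) (j : Fin m) :
    IndepFun (fun ω => (Θ i ω, Δ j ω)) (fun ω => (X i ω, Y j ω)) μ := by
  have hφ : Measurable fun z : (Fin n → ℝ) × (Fin m → ℝ) => (z.1 i, z.2 j) := by fun_prop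
  exact h.indep.comp hφ hφ

lemma Setting.coeff_nonneg (h : Setting μ X Θ Y Δ α₁ α₂) (i : Fin n) (j : Fin m) :
    0 ≤ ∫ ω, Θ i ω ^ α₁ * Δ j ω ^ α₂ ∂μ :=
  integral_rpow_mul_rpow_nonneg (h.nonneg_Θ i) (h.nonneg_Δ j)

lemma Setting.limitTail_nonneg (h : Setting μ X Θ Y Δ α₁ α₂) (x y : ℝ) :
    0 ≤ limitTail μ X Θ Y Δ α₁ α₂ x y :=
  Finset.sum_nonneg fun i _ => Finset.sum_nonneg fun j _ =>
    mul_nonneg (h.coeff_nonneg i j) (jointTail_nonneg _ _ _ _ _)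

lemma Setting.summand_isBigO (h : Setting μ X Θ Y Δ α₁ α₂) (i : Fin n) (j : Fin m) :
    (fun p : ℝ × ℝ => (∫ ω, Θ i ω ^ α₁ * Δ j ω ^ α₂ ∂μ) * jointTail μ (X i) (Y j) p.1 p.2)
      =O[bothToInfty] fun p => limitTail μ X Θ Y Δ α₁ α₂ p.1 p.2 := by
  refine isBigO_of_le _ fun p => ?_
  have h0 : ∀ i j, 0 ≤ (∫ ω, Θ i ω ^ α₁ * Δ j ω ^ α₂ ∂μ) * jointTail μ (X i) (Y j) p.1 p.2 :=
    fun i j => mul_nonneg (h.coeff_nonneg i j) (jointTail_nonneg _ _ _ _ _)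
  rw [Real.norm_of_nonneg (h0 i j), Real.norm_of_nonneg (h.limitTail_nonneg _ _)]
  exact (Finset.single_le_sum (fun j _ => h0 i j) (Finset.mem_univ j)).trans
    (Finset.single_le_sum (f := fun i => ∑ j, (∫ ω, Θ i ω ^ α₁ * Δ j ω ^ α₂ ∂μ) *
      jointTail μ (X i) (Y j) p.1 p.2) (fun i _ => Finset.sum_nonneg fun j _ => h0 i j)
      (Finset.mem_univ i))

variable [IsProbabilityMeasure μ]

lemma Setting.exists_bound (h : Setting μ X Θ Y Δ α₁ α₂) (hn : 0 < n) (hm : 0 < m) :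
    ∃ M : ℝ, 0 < M ∧ (∀ i, ∀ᵐ ω ∂μ, Θ i ω ≤ M) ∧ ∀ j, ∀ᵐ ω ∂μ, Δ j ω ≤ M := by
  choose a ha using fun i =>
    (h.weights i ⟨0, hm⟩).ae_bounded_left (h.measurable_Y _) (h.measurable_Δ _)
  choose b hb using fun j =>
    (h.weights ⟨0, hn⟩ j).symm.ae_bounded_left (h.measurable_X _) (h.measurable_Θ _)
  obtain ⟨A, hA⟩ := Finite.exists_le a
  obtain ⟨B, hB⟩ := Finite.exists_le b
  refine ⟨max (max A B) 1, by positivity, fun i => ?_, fun j => ?_⟩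
  · filter_upwards [ha i] with ω hω
    exact (hω.trans (hA i)).trans ((le_max_left _ _).trans (le_max_left _ _))
  · filter_upwards [hb j] with ω hω
    exact (hω.trans (hB j)).trans ((le_max_right _ _).trans (le_max_left _ _))

lemma Setting.sum_jointTail_isLittleO (h : Setting μ X Θ Y Δ α₁ α₂) (hα₁ : 0 < α₁) (hα₂ : 0 < α₂)
    (hn : 0 < n) (hm : 0 < m) {s : ℝ} (hs : 0 < s) :
    (fun p : ℝ × ℝ => ∑ i, ∑ j,
        jointTail μ (fun ω => Θ i ω * X i ω) (fun ω => Δ j ω * Y j ω) (s * p.1) (s * p.2) -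
        s ^ (-α₁) * s ^ (-α₂) * limitTail μ X Θ Y Δ α₁ α₂ p.1 p.2)
      =o[bothToInfty] fun p => limitTail μ X Θ Y Δ α₁ α₂ p.1 p.2 := by
  obtain ⟨M, hM, hΘM, hΔM⟩ := h.exists_bound hn hm
  have h1 : ∀ i j, _ := fun i j => ((h.regVar i j).weighted_scale_isLittleO hα₁ hα₂
    (h.measurable_X i) (h.measurable_Y j) (h.measurable_Θ i) (h.measurable_Δ j)
    (h.indepFun_pair i j) (h.nonneg_Θ i) (h.nonneg_Δ j) (hΘM i) (hΔM j) hM hs).trans_isBigO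
      (h.summand_isBigO i j)
  refine (IsLittleO.fun_sum (s := Finset.univ) fun i _ =>
    IsLittleO.fun_sum (s := Finset.univ) fun j _ => h1 i j).congr_left fun p => ?_
  simp only [Finset.sum_sub_distrib, limitTail, Finset.mul_sum]

lemma Setting.crossSet_left_isLittleO (h : Setting μ X Θ Y Δ α₁ α₂) (hG : GQAI μ X Y)
    (hα₁ : 0 < α₁) (hα₂ : 0 < α₂) (hn : 0 < n) (hm : 0 < m) {η : ℝ} (hη : 0 < η) :
    (fun p : ℝ × ℝ => μ.real (crossSet (fun i ω => Θ i ω * X i ω) (fun j ω => Δ j ω * Y j ω)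
      (η * p.1) (η * p.2))) =o[bothToInfty] fun p => limitTail μ X Θ Y Δ α₁ α₂ p.1 p.2 := by
  obtain ⟨M, hM, hΘM, hΔM⟩ := h.exists_bound hn hm
  refine crossSet_isLittleO fun i k j hki => ?_
  exact (cross_term_isLittleO (h.regVar k j) (h.regVar i j) hα₁.le hα₂.le (h.measurable_Θ k)
    (h.measurable_Θ i) (h.measurable_Δ j) (h.nonneg_Θ k) (h.nonneg_Θ i) (h.nonneg_Δ j) (hΘM k)
    (hΘM i) (hΔM j) hM hη (hG.left k i j hki)).trans_isBigO
      ((h.summand_isBigO k j).add (h.summand_isBigO i j))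

lemma Setting.crossSet_right_isLittleO (h : Setting μ X Θ Y Δ α₁ α₂) (hG : GQAI μ X Y)
    (hα₁ : 0 < α₁) (hα₂ : 0 < α₂) (hn : 0 < n) (hm : 0 < m) {η : ℝ} (hη : 0 < η) :
    (fun p : ℝ × ℝ => μ.real (crossSet (fun j ω => Δ j ω * Y j ω) (fun i ω => Θ i ω * X i ω)
      (η * p.2) (η * p.1))) =o[bothToInfty] fun p => limitTail μ X Θ Y Δ α₁ α₂ p.1 p.2 := by
  obtain ⟨M, hM, hΘM, hΔM⟩ := h.exists_bound hn hm
  refine crossSet_isLittleO fun j l i hlj => ?_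
  have hcross : Tendsto (fun p : ℝ × ℝ =>
      μ.real {ω | p.1 < |Y l ω| ∧ p.1 < Y j ω ∧ p.2 < X i ω} /
        (jointTail μ (Y l) (X i) p.1 p.2 + jointTail μ (Y j) (X i) p.1 p.2))
      bothToInfty (𝓝 0) := by
    refine ((hG.right l j i hlj).comp tendsto_swap_bothToInfty).congr fun p => ?_
    simp only [Function.comp, Prod.fst_swap, Prod.snd_swap]
    rw [jointTail_comm μ (X i) (Y l), jointTail_comm μ (X i) (Y j)]
  have h1 := (cross_term_isLittleO (h.regVar i l).symm (h.regVar i j).symm hα₂.le hα₁.le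
    (h.measurable_Δ l) (h.measurable_Δ j) (h.measurable_Θ i) (h.nonneg_Δ l) (h.nonneg_Δ j)
    (h.nonneg_Θ i) (hΔM l) (hΔM j) (hΘM i) hM hη hcross).comp_tendsto tendsto_swap_bothToInfty
  refine h1.trans_isBigO (((h.summand_isBigO i l).add (h.summand_isBigO i j)).congr_left
    fun p => ?_)
  simp only [Function.comp, Prod.fst_swap, Prod.snd_swap]
  rw [jointTail_comm μ (X i) (Y l), jointTail_comm μ (X i) (Y j)]
  simp only [mul_comm]

/-- The joint tails of all pairs of single-jump functionals of the weighted terms are equivalent to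
the same sum. The thresholds are perturbed by the factors `1 ± (n + m) η`; since the limit of the
perturbed joint tails is continuous in the factor, `η` can be chosen small. -/
theorem Setting.jointTail_isEquivalent_limitTail (h : Setting μ X Θ Y Δ α₁ α₂) (hG : GQAI μ X Y)
    (hα₁ : 0 < α₁) (hα₂ : 0 < α₂) (hn : 0 < n) (hm : 0 < m) {Z W : Ω → ℝ}
    (hZ : IsSingleJumpFunctional (fun i ω => Θ i ω * X i ω) Z)
    (hW : IsSingleJumpFunctional (fun j ω => Δ j ω * Y j ω) W) :
    (fun p : ℝ × ℝ => jointTail μ Z W p.1 p.2) ~[bothToInfty]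
      fun p => limitTail μ X Θ Y Δ α₁ α₂ p.1 p.2 := by
  refine isLittleO_iff.2 fun ε hε => ?_
  set N : ℝ := n + m with hN
  have hN0 : 0 < N := by positivity
  have hcont : ∀ c : ℝ, Tendsto (fun η : ℝ => (1 + c * η) ^ (-α₁) * (1 + c * η) ^ (-α₂))
      (𝓝[>] 0) (𝓝 1) := fun c => by
    have hlin : Tendsto (fun η : ℝ => 1 + c * η) (𝓝[>] 0) (𝓝 1) := by
      have : Continuous fun η : ℝ => 1 + c * η := by fun_prop
      simpa using (this.tendsto 0).mono_left nhdsWithin_le_nhds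
    simpa using (hlin.rpow_const (p := -α₁) (Or.inl one_ne_zero)).mul
      (hlin.rpow_const (p := -α₂) (Or.inl one_ne_zero))
  obtain ⟨η, ⟨hlo, hup⟩, hη, hη2⟩ : ∃ η : ℝ,
      (1 - ε / 4 < (1 + N * η) ^ (-α₁) * (1 + N * η) ^ (-α₂) ∧
        (1 + -N * η) ^ (-α₁) * (1 + -N * η) ^ (-α₂) < 1 + ε / 4) ∧
      0 < η ∧ η < min 1 (1 / N) := by
    have h1 := (hcont N).eventually (lt_mem_nhds (show 1 - ε / 4 < 1 by linarith))
    have h2 := (hcont (-N)).eventually (gt_mem_nhds (show 1 < 1 + ε / 4 by linarith))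
    have h3 : ∀ᶠ η in 𝓝[>] (0 : ℝ), 0 < η ∧ η < min 1 (1 / N) :=
      Ioo_mem_nhdsGT (by positivity)
    exact ((h1.and h2).and h3).exists
  have hη1 : η ≤ 1 := (hη2.trans_le (min_le_left _ _)).le
  have hNη : N * η < 1 := by
    have := (lt_div_iff₀ hN0).1 (hη2.trans_le (min_le_right _ _))
    linarith
  have hs₁ : 0 < 1 + N * η := by positivity
  have hs₂ : 0 < 1 + -N * η := by linarith
  have hcross := (h.crossSet_left_isLittleO hG hα₁ hα₂ hn hm hη).add
    (h.crossSet_right_isLittleO hG hα₁ hα₂ hn hm hη)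
  filter_upwards [eventually_bothToInfty_pos,
    (h.sum_jointTail_isLittleO hα₁ hα₂ hn hm hs₁).bound (show 0 < ε / 4 by positivity),
    (h.sum_jointTail_isLittleO hα₁ hα₂ hn hm hs₂).bound (show 0 < ε / 4 by positivity),
    hcross.bound (show 0 < ε / 4 by positivity),
    (hcross.const_mul_left (n * m : ℝ)).bound (show 0 < ε / 4 by positivity)]
    with p hp hb₁ hb₂ he₁ he₂
  set L := limitTail μ X Θ Y Δ α₁ α₂ p.1 p.2 with hL
  have hL0 : 0 ≤ L := h.limitTail_nonneg _ _
  have hupper := jointTail_le_sum_add_crossSet (μ := μ) hZ hW hp.1 hp.2 hη hNη.le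
  have hlower := sum_sub_crossSet_le_jointTail (μ := μ)
    (t := fun i ω => Θ i ω * X i ω) (u := fun j ω => Δ j ω * Y j ω)
    (fun i => (h.measurable_Θ i).mul (h.measurable_X i))
    (fun j => (h.measurable_Δ j).mul (h.measurable_Y j)) hZ hW hp.1 hp.2 hη hη1
  rw [← hN] at hupper hlower
  rw [show 1 - N * η = 1 + -N * η by ring] at hupper
  rw [Real.norm_of_nonneg hL0, Real.norm_eq_abs, abs_le] at *
  have hmul₁ := mul_le_mul_of_nonneg_right hlo.le hL0
  have hmul₂ := mul_le_mul_of_nonneg_right hup.le hL0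
  simp only [Pi.sub_apply]
  rw [← hL]
  have hεL : 0 ≤ ε * L := mul_nonneg hε.le hL0
  constructor <;> linarith

end Setting

/-! ### Tail asymptotic independence implies quasi asymptotic independence -/

/-- The conditional probability at thresholds `(x, (x, y))` bounds the quotient, the denominator of
which is at least the probability of the conditioning event. -/
lemma tendsto_cross_of_tendsto_cond {μ : Measure Ω} [IsProbabilityMeasure μ] {U V W : Ω → ℝ}
    (hV : Measurable V) (hW : Measurable W)
    (h : Tendsto (fun q : ℝ × ℝ × ℝ =>
        μ[{ω | q.1 < |U ω|} | {ω | q.2.1 < V ω ∧ q.2.2 < W ω}])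
      (atTop ×ˢ atTop ×ˢ atTop) (𝓝 0)) :
    Tendsto (fun p : ℝ × ℝ => μ.real {ω | p.1 < |U ω| ∧ p.1 < V ω ∧ p.2 < W ω} /
      (jointTail μ U W p.1 p.2 + jointTail μ V W p.1 p.2)) bothToInfty (𝓝 0) := by
  have hdiag : Tendsto (fun p : ℝ × ℝ => (p.1, (p.1, p.2))) bothToInfty
      (atTop ×ˢ atTop ×ˢ atTop) := tendsto_fst.prodMk tendsto_id
  have h1 := (ENNReal.tendsto_toReal ENNReal.zero_ne_top).comp (h.comp hdiag)
  refine squeeze_zero (fun p => div_nonneg measureReal_nonneg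
    (add_nonneg (jointTail_nonneg _ _ _ _ _) (jointTail_nonneg _ _ _ _ _))) (fun p => ?_) h1
  have hmul := cond_mul_eq_inter (measurableSet_jointExcess hV hW p.1 p.2)
    {ω | p.1 < |U ω|} μ
  have hset : {ω | p.1 < V ω ∧ p.2 < W ω} ∩ {ω | p.1 < |U ω|} =
      {ω | p.1 < |U ω| ∧ p.1 < V ω ∧ p.2 < W ω} := by
    ext ω; exact and_comm
  rw [hset] at hmul
  have hreal := congrArg ENNReal.toReal hmul
  rw [ENNReal.toReal_mul] at hreal
  simp only [Function.comp, measureReal_def]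
  rw [← hreal, mul_div_assoc]
  refine mul_le_of_le_one_right ENNReal.toReal_nonneg (div_le_one_of_le₀ ?_
    (add_nonneg (jointTail_nonneg _ _ _ _ _) (jointTail_nonneg _ _ _ _ _)))
  exact le_add_of_nonneg_left (jointTail_nonneg _ _ _ _ _)

lemma GTAI.gqai {n m : ℕ} {μ : Measure Ω} [IsProbabilityMeasure μ] {X : Fin n → Ω → ℝ}
    {Y : Fin m → Ω → ℝ} (h : GTAI μ X Y) (hX : ∀ i, Measurable (X i))
    (hY : ∀ j, Measurable (Y j)) : GQAI μ X Y where
  left i k j hik := tendsto_cross_of_tendsto_cond (hX k) (hY j) (h.left i k j hik)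
  right j k i hjk := by
    refine ((tendsto_cross_of_tendsto_cond (hY k) (hX i) (h.right j k i hjk)).comp
      tendsto_swap_bothToInfty).congr fun p => ?_
    simp only [Function.comp, Prod.fst_swap, Prod.snd_swap]
    rw [jointTail_comm μ (X i) (Y j), jointTail_comm μ (X i) (Y k)]

lemma Setting.integrable_coeff {μ : Measure Ω} [IsProbabilityMeasure μ] {α₁ α₂ : ℝ} {n m : ℕ}
    {X Θ : Fin n → Ω → ℝ} {Y Δ : Fin m → Ω → ℝ} (h : Setting μ X Θ Y Δ α₁ α₂)
    (hα₁ : 0 < α₁) (hα₂ : 0 < α₂) (i : Fin n) (j : Fin m) :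
    Integrable (fun ω => Θ i ω ^ α₁ * Δ j ω ^ α₂) μ := by
  obtain ⟨M, -, hΘM, hΔM⟩ := h.exists_bound i.pos j.pos
  exact integrable_rpow_mul_rpow hα₁.le hα₂.le (h.measurable_Θ i) (h.measurable_Δ j)
    (h.nonneg_Θ i) (h.nonneg_Δ j) (hΘM i) (hΔM j)

end WeightedTails

theorem corollary5p1 {Ω : Type*} [MeasurableSpace Ω] (μ : Measure Ω) [IsProbabilityMeasure μ]
    (α₁ α₂ : ℝ) (hα₁ : 0 < α₁) (hα₂ : 0 < α₂) :
    (∀ (n m : ℕ) (X Θ : Fin n → Ω → ℝ) (Y Δ : Fin m → Ω → ℝ), 0 < n → 0 < m →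
      WeightedTails.Setting μ X Θ Y Δ α₁ α₂ →
      WeightedTails.GQAI μ X Y →
      (∀ i j, Integrable (fun ω => Θ i ω ^ α₁ * Δ j ω ^ α₂) μ) ∧
      ((fun p : ℝ × ℝ => WeightedTails.jointTail μ
          (WeightedTails.weightedSum Θ X) (WeightedTails.weightedSum Δ Y) p.1 p.2)
        ~[WeightedTails.bothToInfty]
        (fun p : ℝ × ℝ => WeightedTails.jointTail μ
          (WeightedTails.maxPartialSum Θ X) (WeightedTails.maxPartialSum Δ Y) p.1 p.2)) ∧
      ((fun p : ℝ × ℝ => WeightedTails.jointTail μ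
          (WeightedTails.maxPartialSum Θ X) (WeightedTails.maxPartialSum Δ Y) p.1 p.2)
        ~[WeightedTails.bothToInfty]
        (fun p : ℝ × ℝ => WeightedTails.limitTail μ X Θ Y Δ α₁ α₂ p.1 p.2))) ∧
    (∀ (n : ℕ) (X Θ Y Δ : Fin n → Ω → ℝ), 0 < n →
      WeightedTails.Setting μ X Θ Y Δ α₁ α₂ →
      WeightedTails.GTAI μ X Y →
      WeightedTails.TAI μ X →
      WeightedTails.TAI μ Y →
      (∀ i, ∃ p : ℝ, (⨆ k, WeightedTails.upperMatuszewska μ (X k)) < (p : EReal) ∧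
        Integrable (fun ω => Θ i ω ^ p) μ) →
      (∀ j, ∃ q : ℝ, (⨆ k, WeightedTails.upperMatuszewska μ (Y k)) < (q : EReal) ∧
        Integrable (fun ω => Δ j ω ^ q) μ) →
      (∀ i j, Integrable (fun ω => Θ i ω ^ α₁ * Δ j ω ^ α₂) μ) ∧
      ((fun p : ℝ × ℝ => WeightedTails.jointTail μ
          (WeightedTails.weightedSum Θ X) (WeightedTails.weightedSum Δ Y) p.1 p.2)
        ~[WeightedTails.bothToInfty]
        (fun p : ℝ × ℝ => WeightedTails.jointTail μ
          (WeightedTails.maxPartialSum Θ X) (WeightedTails.maxPartialSum Δ Y) p.1 p.2)) ∧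
      ((fun p : ℝ × ℝ => WeightedTails.jointTail μ
          (WeightedTails.maxPartialSum Θ X) (WeightedTails.maxPartialSum Δ Y) p.1 p.2)
        ~[WeightedTails.bothToInfty]
        (fun p : ℝ × ℝ => WeightedTails.jointTail μ
          (WeightedTails.maxTerm Θ X) (WeightedTails.maxTerm Δ Y) p.1 p.2)) ∧
      ((fun p : ℝ × ℝ => WeightedTails.jointTail μ
          (WeightedTails.maxTerm Θ X) (WeightedTails.maxTerm Δ Y) p.1 p.2)
        ~[WeightedTails.bothToInfty]
        (fun p : ℝ × ℝ => WeightedTails.limitTail μ X Θ Y Δ α₁ α₂ p.1 p.2))) := by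
  refine ⟨fun n m X Θ Y Δ hn hm hS hG => ⟨hS.integrable_coeff hα₁ hα₂, ?_, ?_⟩,
    fun n X Θ Y Δ hn hS hT _ _ _ _ => ⟨hS.integrable_coeff hα₁ hα₂, ?_, ?_, ?_⟩⟩
  · exact (hS.jointTail_isEquivalent_limitTail hG hα₁ hα₂ hn hm
      (WeightedTails.isSingleJumpFunctional_weightedSum Θ X)
      (WeightedTails.isSingleJumpFunctional_weightedSum Δ Y)).trans
      (hS.jointTail_isEquivalent_limitTail hG hα₁ hα₂ hn hm
        (WeightedTails.isSingleJumpFunctional_maxPartialSum hn Θ X)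
        (WeightedTails.isSingleJumpFunctional_maxPartialSum hm Δ Y)).symm
  · exact hS.jointTail_isEquivalent_limitTail hG hα₁ hα₂ hn hm
      (WeightedTails.isSingleJumpFunctional_maxPartialSum hn Θ X)
      (WeightedTails.isSingleJumpFunctional_maxPartialSum hm Δ Y)
  all_goals
    have hG := hT.gqai hS.measurable_X hS.measurable_Y
    have hsum := hS.jointTail_isEquivalent_limitTail hG hα₁ hα₂ hn hn
      (WeightedTails.isSingleJumpFunctional_weightedSum Θ X)
      (WeightedTails.isSingleJumpFunctional_weightedSum Δ Y)
    have hpartial := hS.jointTail_isEquivalent_limitTail hG hα₁ hα₂ hn hn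
      (WeightedTails.isSingleJumpFunctional_maxPartialSum hn Θ X)
      (WeightedTails.isSingleJumpFunctional_maxPartialSum hn Δ Y)
    have hterm := hS.jointTail_isEquivalent_limitTail hG hα₁ hα₂ hn hn
      (WeightedTails.isSingleJumpFunctional_maxTerm hn Θ X)
      (WeightedTails.isSingleJumpFunctional_maxTerm hn Δ Y)
  · exact hsum.trans hpartial.symm
  · exact hpartial.trans hterm.symm
  · exact hterm
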